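/- Let $m\ge 1$ be the number of items, $[m]=\{1,\dots,m\}$, let $n$ be the number of bidders, and let $d\in\{0,\dots,m-1\}$. For $f:2^{[m]}\to\mathbb R$ write $f(S\mid T)=f(S\cup T)-f(T)$. Call $T\subseteq[m]$ a supermodular set of $f$ if there are $S\subseteq[m]$ and $v\in[m]\setminus T$ with $f(\{v\}\mid S\cup T)>f(\{v\}\mid S\cup T')$ for all $T'\subsetneq T$. Let $\mathrm{SMW}\text{-}d$ be the class of monotone $f$ with $f(\emptyset)=0$ all of whose supermodular sets have at most $d$ elements. Let $\mathrm{SUPADD}$ be the class of monotone $f$ with $f(\emptyset)=0$ and $f(S)+f(T)\le f(S\cup T)$ for all disjoint $S,T$. For a class $\mathcal F$ let $\max(\mathcal F)$ be the class of pointwise maxima of finitely many (at least one) members of $\mathcal F$. In the simultaneous item first price auction (SIA), each bidder $i$, with valuation $f_i$, submits a bid $b_{ij}\ge 0$ for every item $j$. Each item goes to a highest bidder on it, ties being broken by an arbitrary fixed, possibly randomized, (measurable) rule, and the winner pays the winning bid, so bidder $i$ who wins the set $S_i$ has utility $f_i(S_i)-\sum_{j\in S_i}b_{ij}$. A coarse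 correlated equilibrium is a probability distribution over bid profiles for which no bidder can increase the expected utility by deviating unilaterally to a fixed bid vector. The price of anarchy with respect to coarse correlated equilibria for a class $\mathcal F$ is the supremum, over all $f_1,\dots,f_n\in\mathcal F$ and all coarse correlated equilibria, of the ratio $\max_{(S_i)}\sum_i f_i(S_i)$ (over all partitions $(S_1,\dots,S_n)$ of the items) to the expected welfare $\mathbb E\left[\sum_i f_i(S_i)\right]$ in equilibrium (the ratio being $\infty$ if only its denominator is zero, and $0$ if both are zero). **Theorem.** When the bidders have valuations $f_1,\dots,f_n\in\max(\mathrm{SMW}\text{-}d\cap\mathrm{SUPADD})$, SIA has a price of anarchy of at most $$2(d+1)^2\cdot H_{\frac{m}{d+1}}$$ with respect to coarse correlated equilibria, where $H_x=\sum_{k\in\mathbb N,\ 1\le k\le x}\frac1k$. -/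

import Mathlib

open MeasureTheory
open scoped NNReal ENNReal

namespace ItemAuction

/-! ### Set functions and supermodular width -/

/-- Real-valued set functions on the ground set `Fin m` of `m` items. -/
abbrev SetFn (m : ℕ) : Type := Finset (Fin m) → ℝ

/-- The margin `f (S | T) = f (S ∪ T) - f T` of `S` given `T`. -/
def margin {m : ℕ} (f : SetFn m) (S T : Finset (Fin m)) : ℝ := f (S ∪ T) - f T

/-- `T` is a supermodular set w.r.t. `f`: there are `S` and `v ∉ T` such that
`f (v | S ∪ T)` exceeds `f (v | S ∪ T')` for every proper subset `T'` of `T`. -/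
def IsSupermodularSet {m : ℕ} (f : SetFn m) (T : Finset (Fin m)) : Prop :=
  ∃ S : Finset (Fin m), ∃ v : Fin m, v ∉ T ∧
    ∀ T' : Finset (Fin m), T' ⊂ T → margin f {v} (S ∪ T') < margin f {v} (S ∪ T)

open scoped Classical in
/-- The supermodular width: the largest cardinality of a supermodular set
(`0` if there is none). -/
noncomputable def supermodularWidth {m : ℕ} (f : SetFn m) : ℕ :=
  (Finset.univ.filter fun T : Finset (Fin m) => IsSupermodularSet f T).sup Finset.card

/-- The class SMW-`d`: normalized monotone set functions of supermodular width at most `d`. -/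
def SMW (m d : ℕ) : Set (SetFn m) :=
  {f | Monotone f ∧ f ∅ = 0 ∧ supermodularWidth f ≤ d}

/-- The class of (normalized) monotone superadditive set functions. -/
def Superadditive (m : ℕ) : Set (SetFn m) :=
  {f | Monotone f ∧ f ∅ = 0 ∧
    ∀ S T : Finset (Fin m), Disjoint S T → f S + f T ≤ f (S ∪ T)}

/-- The closure of a class under (finite, non-empty) pointwise maxima.
`IsGreatest` of an empty range is false, so `k = 0` never occurs. -/
def maxClosure {m : ℕ} (F : Set (SetFn m)) : Set (SetFn m) :=
  {f | ∃ (k : ℕ) (g : Fin k → SetFn m), (∀ l, g l ∈ F) ∧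
    ∀ S, IsGreatest (Set.range fun l => g l S) (f S)}

/-! ### The simultaneous item first price auction -/

/-- Each of the `n` bidders submits a nonnegative bid on each of the `m` items. -/
abbrev BidProfile (n m : ℕ) : Type := Fin n → Fin m → ℝ≥0

/-- An allocation gives every item to one bidder. -/
abbrev Allocation (n m : ℕ) : Type := Fin m → Fin n

/-- The set of items that bidder `i` receives. -/
def bundle {n m : ℕ} (a : Allocation n m) (i : Fin n) : Finset (Fin m) :=
  Finset.univ.filter fun j => a j = i

/-- A tie-breaking rule: for every bid profile, a probability distribution over allocations
(depending measurably on the bids) under which each item always goes to one of the highest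
bidders on that item. Ties may be broken at random and jointly over the items;
deterministic rules are the case of point masses. -/
structure TieBreakingRule (n m : ℕ) where
  prob : BidProfile n m → Allocation n m → ℝ
  measurable_prob : ∀ a, Measurable fun b => prob b a
  prob_nonneg : ∀ b a, 0 ≤ prob b a
  sum_prob : ∀ b, ∑ a, prob b a = 1
  highest_wins : ∀ b a, prob b a ≠ 0 → ∀ (j : Fin m) (i : Fin n), b i j ≤ b (a j) j

/-- Utility of bidder `i` with valuation `v` (in expectation over the tie-breaking):
the value of the bundle won, minus the bidder's own bids on the items won. -/
noncomputable def utility {n m : ℕ} (R : TieBreakingRule n m) (v : SetFn m) (i : Fin n)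
    (b : BidProfile n m) : ℝ :=
  ∑ a, R.prob b a * (v (bundle a i) - ∑ j ∈ bundle a i, (b i j : ℝ))

/-- The welfare of an allocation. -/
def welfare {n m : ℕ} (f : Fin n → SetFn m) (a : Allocation n m) : ℝ :=
  ∑ i, f i (bundle a i)

/-- The optimal welfare. -/
noncomputable def optWelfare {n m : ℕ} (f : Fin n → SetFn m) : ℝ :=
  ⨆ a : Allocation n m, welfare f a

/-- The welfare of the auction's outcome (in expectation over the tie-breaking). -/
noncomputable def auctionWelfare {n m : ℕ} (R : TieBreakingRule n m) (f : Fin n → SetFn m)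
    (b : BidProfile n m) : ℝ :=
  ∑ a, R.prob b a * welfare f a

/-- `D` is a coarse correlated equilibrium (of the full-information game with valuations `f`):
a probability distribution over bid profiles such that no bidder gains in expectation by
deviating unilaterally to a fixed bid vector `x`. The utility of a bidder is bounded above and
measurable, so if it is not integrable its expectation is `-∞`, which is less than what
bidding zero gives; such a `D` is not an equilibrium. -/
structure IsCoarseCorrelatedEquilibrium {n m : ℕ} (R : TieBreakingRule n m)
    (f : Fin n → SetFn m) (D : Measure (BidProfile n m)) : Prop where
  isProbabilityMeasure : IsProbabilityMeasure D
  integrable_utility : ∀ i, Integrable (utility R (f i) i) D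
  deviation_le : ∀ (i : Fin n) (x : Fin m → ℝ≥0),
    ∫ b, utility R (f i) i (Function.update b i x) ∂D ≤ ∫ b, utility R (f i) i b ∂D

/-- The price of anarchy of the auction w.r.t. coarse correlated equilibria, for valuations
in `F`: the supremum, over all valuation profiles from `F` and all coarse correlated equilibria,
of the optimal welfare over the expected equilibrium welfare. In `ℝ≥0∞`, the ratio is `∞` if
only the equilibrium welfare vanishes, and `0` if both vanish. -/
noncomputable def priceOfAnarchy {n m : ℕ} (R : TieBreakingRule n m) (F : Set (SetFn m)) :
    ℝ≥0∞ :=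
  ⨆ (f : Fin n → SetFn m) (_ : ∀ i, f i ∈ F) (D : Measure (BidProfile n m))
    (_ : IsCoarseCorrelatedEquilibrium R f D),
    ENNReal.ofReal (optWelfare f) / ENNReal.ofReal (∫ b, auctionWelfare R f b ∂D)

end ItemAuction

/-! Write `k = d + 1`. Width at most `d` bounds every margin by the value of some set of at most `k`
items. Greedily splitting `S` into blocks of size at most `k` and maximal value thus gives total
block value `V` with `f S ≤ k * V`. By superadditivity a bidder holding `T` keeps every block inside
`T`. Each item of a block carries the block's value as its loss `W j`, so `∑ W ≤ k * V`
(`exists_hasItemLosses`).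

In the auction, let a bidder bid `t * W` with `t` nearly uniform on `(0, 1/k]`. Payments average
about `V / 2` at most, and item `j` costs at most `k` times its price in expected loss, so the
equilibrium utility is at least `V / 2 - k * (prices on S)` (`le_integral_utility`). Utilities and
prices add up to the welfare, whence `∑ V ≤ 2k * welfare` and the optimum is at most `2k² *
welfare`. The harmonic factor enters only through being at least `1`. -/

namespace ItemAuction

/-! ### Greedy block decomposition of valuations -/

section Valuations

variable {m d : ℕ} {f : SetFn m}

/-- A set of more than `d` items is not supermodular, so some proper subset has at least the same
margin; descend until the size is at most `d`. -/
theorem exists_small_subset_marginal_ge (hw : supermodularWidth f ≤ d) (v : Fin m)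
    (T : Finset (Fin m)) (hv : v ∉ T) :
    ∃ T' ⊆ T, T'.card ≤ d ∧ f (insert v T) - f T ≤ f (insert v T') - f T' := by
  induction T using Finset.strongInduction with
  | H T ih =>
    by_cases hT : T.card ≤ d
    · exact ⟨T, subset_rfl, hT, le_rfl⟩
    · have hns : ¬ IsSupermodularSet f T := by
        intro h
        apply hT
        refine le_trans ?_ hw
        unfold supermodularWidth
        exact Finset.le_sup (f := Finset.card) (by simpa using h)
      unfold IsSupermodularSet at hns
      push Not at hns
      obtain ⟨T₁, hT₁, h₁⟩ := hns ∅ v hv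
      simp only [margin, Finset.empty_union, ← Finset.insert_eq] at h₁
      obtain ⟨T₂, hT₂, hc, h₂⟩ := ih T₁ hT₁ (fun h => hv (hT₁.subset h))
      exact ⟨T₂, hT₂.trans hT₁.subset, hc, h₁.trans h₂⟩

/-- Remove the items of `e` one at a time: each margin is at most the value of a set of at most `d +
1` items of `S`. -/
theorem le_sdiff_add_card_mul (hmono : Monotone f) (h0 : f ∅ = 0)
    (hw : supermodularWidth f ≤ d) {S : Finset (Fin m)} {M : ℝ}
    (hM : ∀ T ⊆ S, T.Nonempty → T.card ≤ d + 1 → f T ≤ M) (e : Finset (Fin m)) (he : e ⊆ S) :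
    f S ≤ f (S \ e) + e.card * M := by
  induction e using Finset.induction_on with
  | empty => simp
  | insert v e hv ih =>
    have h₁ := ih (fun x hx => he (Finset.mem_insert_of_mem hx))
    obtain ⟨T, hT, hc, h₂⟩ := exists_small_subset_marginal_ge hw v (S \ insert v e) (by simp)
    have hvS : v ∈ S := he (Finset.mem_insert_self v e)
    have hins : insert v (S \ insert v e) = S \ e := by
      ext x
      by_cases hx : x = v
      · subst hx; simp [hvS, hv]
      · simp [hx]
    rw [hins] at h₂
    have h₃ : f (insert v T) ≤ M := by
      refine hM _ ?_ (Finset.insert_nonempty _ _) ((Finset.card_insert_le _ _).trans (by omega))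
      exact Finset.insert_subset hvS (hT.trans Finset.sdiff_subset)
    have h₄ : 0 ≤ f T := h0 ▸ hmono (Finset.empty_subset T)
    rw [Finset.card_insert_of_notMem hv]
    push_cast
    linarith

/-- Item losses `W`, supported on `S`, such that a bidder holding `T` retains at least `V` minus
the losses of the items of `S` missing from `T`, where `V` is at least a `1 / k` fraction of `f S`
and the total loss is at most `k * V`. -/
def HasItemLosses (k : ℕ) (f : SetFn m) (S : Finset (Fin m)) (W : Fin m → ℝ≥0) (V : ℝ) : Prop :=
  (∀ j ∉ S, W j = 0) ∧ ∑ j, (W j : ℝ) ≤ k * V ∧ f S ≤ k * V ∧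
    ∀ T, V - ∑ j ∈ S \ T, (W j : ℝ) ≤ f T

theorem exists_hasItemLosses (hf : f ∈ SMW m d ∩ Superadditive m) (S : Finset (Fin m)) :
    ∃ W V, HasItemLosses (d + 1) f S W V := by
  obtain ⟨⟨hmono, h0, hw⟩, -, -, hsup⟩ := hf
  have hnn : ∀ T, 0 ≤ f T := fun T => h0 ▸ hmono (Finset.empty_subset T)
  induction S using Finset.strongInduction with
  | H S ih =>
    rcases S.eq_empty_or_nonempty with rfl | ⟨v, hv⟩
    · exact ⟨0, 0, by simp, by simp, by simp [h0], fun T => by simpa using hnn T⟩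
    -- The next greedy block `e`.
    obtain ⟨e, he, hmax⟩ := Finset.exists_max_image
      (S.powerset.filter fun T => T.Nonempty ∧ T.card ≤ d + 1) f
      ⟨{v}, by simp [hv]⟩
    simp only [Finset.mem_filter, Finset.mem_powerset] at he hmax
    obtain ⟨heS, hene, hec⟩ := he
    obtain ⟨W, V, hW0, hWV, hSV, hT⟩ := ih (S \ e)
      (Finset.sdiff_ssubset heS hene)
    have hlose := le_sdiff_add_card_mul hmono h0 hw
      (fun T hTS hTne hTc => hmax T ⟨hTS, hTne, hTc⟩) e heS
    have hecR : (e.card : ℝ) * f e ≤ ((d + 1 : ℕ) : ℝ) * f e :=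
      mul_le_mul_of_nonneg_right (by exact_mod_cast hec) (hnn e)
    have hcoe : ((f e).toNNReal : ℝ) = f e := Real.coe_toNNReal _ (hnn e)
    refine ⟨fun j => W j + if j ∈ e then (f e).toNNReal else 0, V + f e, ?_, ?_, ?_, ?_⟩
    · intro j hj
      have hje : j ∉ e := fun h => hj (heS h)
      simp [hje, hW0 j (by simp [hj])]
    · have : ∑ j, ((W j + if j ∈ e then (f e).toNNReal else 0 : ℝ≥0) : ℝ)
          = ∑ j, (W j : ℝ) + e.card * f e := by
        simp only [NNReal.coe_add, Finset.sum_add_distrib]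
        congr 1
        simp [apply_ite, hcoe, Finset.sum_ite_mem]
      rw [this]
      linarith
    · linarith
    · intro T
      by_cases heT : e ⊆ T
      · have hsum : ∑ j ∈ S \ T, ((W j + if j ∈ e then (f e).toNNReal else 0 : ℝ≥0) : ℝ)
            = ∑ j ∈ (S \ e) \ (T \ e), (W j : ℝ) := by
          have : (S \ e) \ (T \ e) = S \ T := by
            ext x
            have := @heT x
            simp only [Finset.mem_sdiff]
            tauto
          rw [this]
          refine Finset.sum_congr rfl fun j hj => ?_
          have hje : j ∉ e := fun h => (Finset.mem_sdiff.1 hj).2 (heT h)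
          simp [hje]
        -- An intact block adds its full value by superadditivity.
        have h₁ := hsup (T \ e) e Finset.sdiff_disjoint
        rw [Finset.sdiff_union_of_subset heT] at h₁
        have h₂ := hT (T \ e)
        rw [hsum]
        linarith
      -- A broken block is paid for by the loss of a single missing item.
      · obtain ⟨j₀, hj₀e, hj₀T⟩ := Finset.not_subset.1 heT
        have h₁ : ∑ j ∈ (S \ e) \ T, (W j : ℝ) ≤ ∑ j ∈ S \ T, (W j : ℝ) :=
          Finset.sum_le_sum_of_subset_of_nonneg
            (Finset.sdiff_subset_sdiff Finset.sdiff_subset subset_rfl) (fun _ _ _ => NNReal.coe_nonneg _)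
        have h₂ : f e ≤ ∑ j ∈ S \ T, ((if j ∈ e then (f e).toNNReal else 0 : ℝ≥0) : ℝ) := by
          refine le_trans ?_ (Finset.single_le_sum (fun _ _ => NNReal.coe_nonneg _)
            (Finset.mem_sdiff.2 ⟨heS hj₀e, hj₀T⟩))
          simp [hj₀e, hcoe]
        have h₃ := hT T
        simp only [NNReal.coe_add, Finset.sum_add_distrib]
        linarith

/-- Use the function attaining the maximum at `S`; on every other set it is a lower bound for `f`.
-/
theorem exists_hasItemLosses_of_mem_maxClosure
    (hf : f ∈ maxClosure (SMW m d ∩ Superadditive m)) (S : Finset (Fin m)) :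
    ∃ W V, HasItemLosses (d + 1) f S W V := by
  obtain ⟨k, g, hg, hmax⟩ := hf
  obtain ⟨l, hl⟩ := (hmax S).1
  obtain ⟨W, V, hW, hWV, hSV, hT⟩ := exists_hasItemLosses (hg l) S
  exact ⟨W, V, hW, hWV, hl ▸ hSV, fun T => (hT T).trans ((hmax T).2 ⟨l, rfl⟩)⟩

theorem nonneg_of_mem_maxClosure
    (hf : f ∈ maxClosure (SMW m d ∩ Superadditive m)) (S : Finset (Fin m)) : 0 ≤ f S := by
  obtain ⟨k, g, hg, hmax⟩ := hf
  obtain ⟨l, hl⟩ := (hmax S).1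
  obtain ⟨⟨hmono, h0, -⟩, -⟩ := hg l
  rw [← hl]
  exact h0 ▸ hmono (Finset.empty_subset S)

end Valuations

/-- The count is at most the largest `s` counted, and that `s` satisfies `s * W ≤ c`. -/
theorem mul_card_filter_mul_le {N : ℕ} {W c : ℝ} (hc : 0 ≤ c) (hW : 0 ≤ W) :
    W * ((Finset.Icc 1 N).filter fun s : ℕ => s * W ≤ c).card ≤ c := by
  set A := (Finset.Icc 1 N).filter fun s : ℕ => s * W ≤ c with hA
  rcases A.eq_empty_or_nonempty with h | h
  · simpa [h] using hc
  have hs := A.max'_mem h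
  set s := A.max' h with hs'
  have hcard : A.card ≤ s := by
    have : A ⊆ Finset.Icc 1 s := fun x hx =>
      Finset.mem_Icc.2 ⟨(Finset.mem_Icc.1 (Finset.mem_filter.1 hx).1).1, A.le_max' x hx⟩
    simpa using Finset.card_le_card this
  have h₁ : (s : ℝ) * W ≤ c := (Finset.mem_filter.1 hs).2
  have h₂ : (A.card : ℝ) * W ≤ s * W := mul_le_mul_of_nonneg_right (by exact_mod_cast hcard) hW
  linarith

/-! ### Deviations for a fixed bid profile -/

section Auction

variable {n m : ℕ} {R : TieBreakingRule n m}

/-- The highest bid on item `j`. -/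
def price (b : BidProfile n m) (j : Fin m) : ℝ≥0 := Finset.univ.sup fun i => b i j

theorem le_price (b : BidProfile n m) (i : Fin n) (j : Fin m) : b i j ≤ price b j :=
  Finset.le_sup (f := fun i => b i j) (Finset.mem_univ i)

theorem price_eq (b : BidProfile n m) {a : Allocation n m} (ha : R.prob b a ≠ 0) (j : Fin m) :
    price b j = b (a j) j :=
  le_antisymm (Finset.sup_le fun i _ => R.highest_wins b a ha j i) (le_price b _ _)

theorem measurable_price (j : Fin m) : Measurable fun b : BidProfile n m => price b j := by
  unfold price
  induction (Finset.univ : Finset (Fin n)) using Finset.induction_on with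
  | empty => simp
  | insert i s _ ih =>
    simp only [Finset.sup_insert]
    have hi : Measurable fun b : BidProfile n m => b i j :=
      (measurable_pi_apply j).comp (measurable_pi_apply i)
    exact hi.sup ih

theorem measurable_bid (i : Fin n) (j : Fin m) :
    Measurable fun b : BidProfile n m => (b i j : ℝ) :=
  ((measurable_pi_apply j).comp (measurable_pi_apply i)).coe_nnreal_real

theorem measurable_utility (v : SetFn m) (i : Fin n) : Measurable (utility R v i) := by
  unfold utility
  refine Finset.measurable_sum _ fun a _ => (R.measurable_prob a).mul
    (measurable_const.sub (Finset.measurable_sum _ fun j _ => measurable_bid i j))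

theorem measurable_auctionWelfare (f : Fin n → SetFn m) : Measurable (auctionWelfare R f) := by
  unfold auctionWelfare
  exact Finset.measurable_sum _ fun a _ => (R.measurable_prob a).mul_const _

theorem le_sum_prob_mul {b : BidProfile n m} {g : Allocation n m → ℝ} {c : ℝ}
    (h : ∀ a, R.prob b a ≠ 0 → c ≤ g a) : c ≤ ∑ a, R.prob b a * g a := by
  calc c = ∑ a, R.prob b a * c := by rw [← Finset.sum_mul, R.sum_prob, one_mul]
    _ ≤ _ := by
      refine Finset.sum_le_sum fun a _ => ?_
      by_cases ha : R.prob b a = 0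
      · simp [ha]
      · exact mul_le_mul_of_nonneg_left (h a ha) (R.prob_nonneg b a)

theorem abs_sum_prob_mul_le (b : BidProfile n m) (g : Allocation n m → ℝ) :
    |∑ a, R.prob b a * g a| ≤ ∑ a, |g a| := by
  refine (Finset.abs_sum_le_sum_abs _ _).trans (Finset.sum_le_sum fun a _ => ?_)
  rw [abs_mul, abs_of_nonneg (R.prob_nonneg b a)]
  refine mul_le_of_le_one_left (abs_nonneg _) ?_
  rw [← R.sum_prob b]
  exact Finset.single_le_sum (fun a _ => R.prob_nonneg b a) (Finset.mem_univ a)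

theorem sum_sum_bundle (a : Allocation n m) (g : Fin n → Fin m → ℝ) :
    ∑ i, ∑ j ∈ bundle a i, g i j = ∑ j, g (a j) j := by
  simp only [bundle, Finset.sum_filter]
  rw [Finset.sum_comm]
  simp

theorem sum_utility (R : TieBreakingRule n m) (f : Fin n → SetFn m) (b : BidProfile n m) :
    ∑ i, utility R (f i) i b = auctionWelfare R f b - ∑ j, (price b j : ℝ) := by
  have h : ∑ j, (price b j : ℝ) = ∑ a, R.prob b a * ∑ j, (price b j : ℝ) := by
    rw [← Finset.sum_mul, R.sum_prob, one_mul]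
  rw [h, auctionWelfare, ← Finset.sum_sub_distrib]
  unfold utility
  rw [Finset.sum_comm]
  refine Finset.sum_congr rfl fun a _ => ?_
  by_cases ha : R.prob b a = 0
  · simp [ha]
  rw [← Finset.mul_sum, ← mul_sub, Finset.sum_sub_distrib, sum_sum_bundle a fun i j => (b i j : ℝ)]
  simp only [welfare, price_eq b ha]

theorem le_utility_update {k : ℕ} {v : SetFn m} {S : Finset (Fin m)} {W : Fin m → ℝ≥0} {V : ℝ}
    (hv : HasItemLosses k v S W V) (i : Fin n) (b : BidProfile n m) (t : ℝ≥0) :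
    V - (∑ j ∈ S, if t * W j ≤ price b j then (W j : ℝ) else 0) - t * ∑ j, (W j : ℝ)
      ≤ utility R v i (Function.update b i fun j => t * W j) := by
  obtain ⟨-, -, -, hT⟩ := hv
  refine le_sum_prob_mul fun a ha => ?_
  have hlost : ∑ j ∈ S \ bundle a i, (W j : ℝ) ≤
      ∑ j ∈ S, if t * W j ≤ price b j then (W j : ℝ) else 0 := by
    calc ∑ j ∈ S \ bundle a i, (W j : ℝ)
        = ∑ j ∈ S \ bundle a i, if t * W j ≤ price b j then (W j : ℝ) else 0 := by
          refine Finset.sum_congr rfl fun j hj => ?_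
          have hji : a j ≠ i := by simpa [bundle] using (Finset.mem_sdiff.1 hj).2
          have h₁ := R.highest_wins _ a ha j i
          rw [Function.update_self, Function.update_of_ne hji] at h₁
          -- `price b` also counts the deviator's own old bid, which only enlarges the bound; ties
          -- count as lost.
          rw [if_pos (h₁.trans (le_price b _ _))]
      _ ≤ _ := Finset.sum_le_sum_of_subset_of_nonneg Finset.sdiff_subset
          fun j _ _ => by split_ifs <;> simp
  have hpay : ∑ j ∈ bundle a i, ((Function.update b i (fun j => t * W j) i j : ℝ≥0) : ℝ)
      ≤ t * ∑ j, (W j : ℝ) := by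
    rw [Finset.mul_sum]
    simp only [Function.update_self, NNReal.coe_mul]
    exact Finset.sum_le_sum_of_subset_of_nonneg (Finset.subset_univ _) fun j _ _ => by positivity
  have := hT (bundle a i)
  linarith

/-- Sums over the grid `t = s / (k * N)`, a discrete stand-in for uniform `t` on `(0, 1/k]`: item
`j` is lost for few enough `s` that its total loss is at most `k * N * price b j`. -/
theorem le_sum_utility_update {k : ℕ} (hk : 0 < k) {v : SetFn m} {S : Finset (Fin m)}
    {W : Fin m → ℝ≥0} {V : ℝ} (hv : HasItemLosses k v S W V) (i : Fin n) (b : BidProfile n m)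
    {N : ℕ} (hN : 0 < N) :
    ((N : ℝ) - 1) / 2 * V - k * N * ∑ j ∈ S, (price b j : ℝ) ≤
      ∑ s ∈ Finset.Icc 1 N,
        utility R v i (Function.update b i fun j => (s / (k * N) : ℝ≥0) * W j) := by
  have hkR : (0 : ℝ) < k := by exact_mod_cast hk
  have hNR : (0 : ℝ) < N := by exact_mod_cast hN
  refine le_trans ?_ (Finset.sum_le_sum fun s _ => le_utility_update hv i b _)
  rw [Finset.sum_sub_distrib, Finset.sum_sub_distrib, ← Finset.sum_mul, Finset.sum_comm]
  have h₁ : ∑ j ∈ S, ∑ s ∈ Finset.Icc 1 N,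
      (if (s / (k * N) : ℝ≥0) * W j ≤ price b j then (W j : ℝ) else 0)
        ≤ k * N * ∑ j ∈ S, (price b j : ℝ) := by
    rw [Finset.mul_sum]
    refine Finset.sum_le_sum fun j _ => ?_
    rw [← Finset.sum_filter, Finset.sum_const, nsmul_eq_mul, mul_comm]
    refine le_trans (le_of_eq ?_) (mul_card_filter_mul_le (N := N) (W := W j)
      (c := k * N * price b j) (by positivity) (by positivity))
    congr 3
    refine Finset.filter_congr fun s _ => ?_
    rw [← NNReal.coe_le_coe]
    push_cast
    rw [div_mul_eq_mul_div, div_le_iff₀ (by positivity), mul_comm (price b j : ℝ)]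
  have h₂ : ∑ s ∈ Finset.Icc 1 N, ((s / (k * N) : ℝ≥0) : ℝ) = (N + 1) / (2 * k) := by
    push_cast
    rw [← Finset.sum_div]
    have : ∑ s ∈ Finset.Icc 1 N, (s : ℝ) = N * (N + 1) / 2 := by
      clear * -
      induction N with
      | zero => simp
      | succ N ih => rw [Finset.sum_Icc_succ_top (by omega), ih]; push_cast; ring
    rw [this]
    field_simp
  have h₃ : ((N : ℝ) + 1) / (2 * k) * ∑ j, (W j : ℝ) ≤ (N + 1) / 2 * V := by
    refine (mul_le_mul_of_nonneg_left hv.2.1 (by positivity)).trans (le_of_eq ?_)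
    field_simp
  rw [h₂, Finset.sum_const, Nat.card_Icc, nsmul_eq_mul]
  simp only [Nat.add_sub_cancel]
  linarith

theorem sum_sum_bundle_price (a : Allocation n m) (g : Fin m → ℝ) :
    ∑ i, ∑ j ∈ bundle a i, g j = ∑ j, g j :=
  sum_sum_bundle a fun _ => g

/-! ### Expectations in equilibrium -/

variable {f : Fin n → SetFn m} {D : Measure (BidProfile n m)}

theorem integrable_auctionWelfare [IsFiniteMeasure D] (R : TieBreakingRule n m)
    (f : Fin n → SetFn m) : Integrable (auctionWelfare R f) D :=
  Integrable.of_bound (measurable_auctionWelfare f).aestronglyMeasurable (∑ a, |welfare f a|)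
    (Filter.Eventually.of_forall fun b => abs_sum_prob_mul_le b _)

theorem integrable_utility_update [IsFiniteMeasure D] (R : TieBreakingRule n m) (v : SetFn m)
    (i : Fin n) (x : Fin m → ℝ≥0) :
    Integrable (fun b => utility R v i (Function.update b i x)) D := by
  refine Integrable.of_bound (C := ∑ a, |v (bundle a i) - ∑ j ∈ bundle a i, (x j : ℝ)|)
    ((measurable_utility v i).comp ?_).aestronglyMeasurable
    (Filter.Eventually.of_forall fun b => ?_)
  · exact measurable_update_left
  · simp only [utility, Function.update_self, Real.norm_eq_abs]
    exact abs_sum_prob_mul_le _ _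

/-- Bids are unbounded, but total price is bounded welfare minus integrable utilities, and it
dominates each price. -/
theorem integrable_price (hD : IsCoarseCorrelatedEquilibrium R f D) (j : Fin m) :
    Integrable (fun b => (price b j : ℝ)) D := by
  have := hD.isProbabilityMeasure
  have hrev : Integrable (fun b => ∑ j, (price b j : ℝ)) D := by
    have h := (integrable_auctionWelfare (D := D) R f).sub
      (integrable_finsetSum Finset.univ fun i _ => hD.integrable_utility i)
    refine h.congr (Filter.Eventually.of_forall fun b => ?_)
    simp only [Pi.sub_apply, sum_utility]
    ring
  refine hrev.mono (measurable_price j).coe_nnreal_real.aestronglyMeasurable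
    (Filter.Eventually.of_forall fun b => ?_)
  rw [Real.norm_of_nonneg (by positivity), Real.norm_of_nonneg (by positivity)]
  exact Finset.single_le_sum (f := fun j => (price b j : ℝ)) (fun _ _ => by positivity)
    (Finset.mem_univ j)

theorem integral_utility_nonneg (hD : IsCoarseCorrelatedEquilibrium R f D)
    (hf : ∀ i S, 0 ≤ f i S) (i : Fin n) : 0 ≤ ∫ b, utility R (f i) i b ∂D := by
  refine le_trans (integral_nonneg fun b => ?_) (hD.deviation_le i 0)
  exact Finset.sum_nonneg fun a _ =>
    mul_nonneg (R.prob_nonneg _ _) (by simpa using hf i (bundle a i))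

theorem sum_integral_utility (hD : IsCoarseCorrelatedEquilibrium R f D) :
    ∑ i, ∫ b, utility R (f i) i b ∂D =
      ∫ b, auctionWelfare R f b ∂D - ∑ j, ∫ b, (price b j : ℝ) ∂D := by
  have := hD.isProbabilityMeasure
  rw [← integral_finsetSum _ fun i _ => hD.integrable_utility i,
    ← integral_finsetSum _ fun j _ => integrable_price hD j,
    ← integral_sub (integrable_auctionWelfare R f)
      (integrable_finsetSum _ fun j _ => integrable_price hD j)]
  exact integral_congr_ae (Filter.Eventually.of_forall fun b => sum_utility R f b)

/-- Each grid deviation is unprofitable; average over the grid and let `N → ∞`. -/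
theorem le_integral_utility {k : ℕ} (hk : 0 < k) (hD : IsCoarseCorrelatedEquilibrium R f D)
    (i : Fin n) {S : Finset (Fin m)} {W : Fin m → ℝ≥0} {V : ℝ}
    (hv : HasItemLosses k (f i) S W V) :
    V / 2 - k * ∑ j ∈ S, ∫ b, (price b j : ℝ) ∂D ≤ ∫ b, utility R (f i) i b ∂D := by
  have := hD.isProbabilityMeasure
  set P := ∑ j ∈ S, ∫ b, (price b j : ℝ) ∂D
  set U := ∫ b, utility R (f i) i b ∂D
  have hbound : ∀ N : ℕ, 0 < N → ((N : ℝ) - 1) / 2 * V - k * N * P ≤ N * U := by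
    intro N hN
    have hPint : Integrable (fun b => ∑ j ∈ S, (price b j : ℝ)) D :=
      integrable_finsetSum _ fun j _ => integrable_price hD j
    have h₁ := integral_mono (μ := D)
      ((integrable_const (((N : ℝ) - 1) / 2 * V)).sub (hPint.const_mul (k * N : ℝ)))
      (integrable_finsetSum _ fun s _ => integrable_utility_update R (f i) i _)
      (fun b => le_sum_utility_update (R := R) hk hv i b hN)
    simp only [Pi.sub_apply] at h₁
    rw [integral_sub (integrable_const _) (hPint.const_mul _), integral_const,
      integral_const_mul (k * N : ℝ) (fun b => ∑ j ∈ S, (price b j : ℝ)),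
      integral_finsetSum _ fun j _ => integrable_price hD j,
      integral_finsetSum _ fun s _ => integrable_utility_update R (f i) i _] at h₁
    have h₂ := h₁.trans (Finset.sum_le_sum fun s _ => hD.deviation_le i _)
    simpa using h₂
  have hlim : Filter.Tendsto (fun N : ℕ => V / 2 - k * P - V / 2 * (1 / ((N : ℝ) + 1)))
      Filter.atTop (nhds (V / 2 - k * P - V / 2 * 0)) :=
    tendsto_const_nhds.sub (tendsto_one_div_add_atTop_nhds_zero_nat.const_mul _)
  rw [mul_zero, sub_zero] at hlim
  refine le_of_tendsto' hlim fun N => ?_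
  have h := hbound (N + 1) N.succ_pos
  push_cast at h
  have hN : (0 : ℝ) < (N : ℝ) + 1 := by positivity
  refine le_of_mul_le_mul_left (le_trans (le_of_eq ?_) h) hN
  field_simp
  ring

theorem welfare_le_mul_integral_auctionWelfare {k : ℕ} (hk : 0 < k)
    (hD : IsCoarseCorrelatedEquilibrium R f D) (hf : ∀ i S, 0 ≤ f i S)
    (hv : ∀ i S, ∃ W V, HasItemLosses k (f i) S W V) (a : Allocation n m) :
    welfare f a ≤ 2 * (k : ℝ) ^ 2 * ∫ b, auctionWelfare R f b ∂D := by
  choose W V hWV using fun i => hv i (bundle a i)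
  have hk1 : (1 : ℝ) ≤ k := by exact_mod_cast hk
  have hU := sum_integral_utility hD
  have hU0 : 0 ≤ ∑ i, ∫ b, utility R (f i) i b ∂D :=
    Finset.sum_nonneg fun i _ => integral_utility_nonneg hD hf i
  have hdev := Finset.sum_le_sum fun i (_ : i ∈ Finset.univ) => le_integral_utility hk hD i (hWV i)
  rw [Finset.sum_sub_distrib, ← Finset.sum_div, ← Finset.mul_sum, sum_sum_bundle_price] at hdev
  have hopt : welfare f a ≤ k * ∑ i, V i := by
    rw [Finset.mul_sum]
    exact Finset.sum_le_sum fun i _ => (hWV i).2.2.1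
  have h₁ : ∑ i, V i ≤ 2 * k * ∫ b, auctionWelfare R f b ∂D := by
    -- As total utility is nonnegative and `1 ≤ k`, scaling it by `k` makes it combine with `k`
    -- times the prices.
    have := le_mul_of_one_le_left hU0 hk1
    have h₂ : (k : ℝ) * ∑ i, ∫ b, utility R (f i) i b ∂D =
      k * ∫ b, auctionWelfare R f b ∂D - k * ∑ j, ∫ b, (price b j : ℝ) ∂D := by rw [hU]; ring
    linarith
  calc welfare f a ≤ k * ∑ i, V i := hopt
    _ ≤ k * (2 * k * ∫ b, auctionWelfare R f b ∂D) := by gcongr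
    _ = _ := by ring

end Auction

theorem one_le_harmonic {N : ℕ} (hN : 1 ≤ N) : 1 ≤ harmonic N := by
  unfold harmonic
  refine le_trans ?_ (Finset.single_le_sum (f := fun i : ℕ => ((↑(i + 1) : ℚ))⁻¹)
    (fun i _ => by positivity) (Finset.mem_range.2 hN))
  simp

end ItemAuction

/-! ### The price of anarchy bound -/

theorem mainTheorem11 (n m d : ℕ) (hd : d < m) (R : ItemAuction.TieBreakingRule n m) :
    ItemAuction.priceOfAnarchy R
        (ItemAuction.maxClosure (ItemAuction.SMW m d ∩ ItemAuction.Superadditive m)) ≤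
      ENNReal.ofReal (2 * ((d : ℝ) + 1) ^ 2 * (harmonic ⌊(m : ℝ) / ((d : ℝ) + 1)⌋₊ : ℝ)) := by
  refine iSup_le fun f => iSup_le fun hf => iSup_le fun D => iSup_le fun hD => ?_
  -- Without allocations the tie-breaking probabilities would sum to `0`.
  have hne : Nonempty (ItemAuction.Allocation n m) := by
    by_contra h
    rw [not_nonempty_iff] at h
    simpa using R.sum_prob 0
  have hfloor : 1 ≤ ⌊(m : ℝ) / ((d : ℝ) + 1)⌋₊ := by
    rw [Nat.one_le_floor_iff, one_le_div₀ (by positivity)]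
    exact_mod_cast hd
  have hharm : (1 : ℝ) ≤ (harmonic ⌊(m : ℝ) / ((d : ℝ) + 1)⌋₊ : ℝ) := by
    exact_mod_cast ItemAuction.one_le_harmonic hfloor
  have hnn : ∀ i S, 0 ≤ f i S := fun i => ItemAuction.nonneg_of_mem_maxClosure (hf i)
  have hopt : ItemAuction.optWelfare f ≤
      2 * ((d : ℝ) + 1) ^ 2 * ∫ b, ItemAuction.auctionWelfare R f b ∂D := by
    refine ciSup_le fun a => ?_
    simpa using ItemAuction.welfare_le_mul_integral_auctionWelfare d.succ_pos hD hnn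
      (fun i => ItemAuction.exists_hasItemLosses_of_mem_maxClosure (hf i)) a
  refine ENNReal.div_le_of_le_mul ?_
  rw [← ENNReal.ofReal_mul (by positivity)]
  refine ENNReal.ofReal_le_ofReal (hopt.trans ?_)
  have hW : 0 ≤ ∫ b, ItemAuction.auctionWelfare R f b ∂D :=
    integral_nonneg fun b => Finset.sum_nonneg fun a _ =>
      mul_nonneg (R.prob_nonneg b a) (Finset.sum_nonneg fun i _ => hnn i _)
  refine mul_le_mul_of_nonneg_right ?_ hW
  exact le_mul_of_one_le_right (by positivity) hharm
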